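/- Let $K$ be a perfect field, $C$ an algebraic closure of $K$, and $L$ with $K\subseteq L\subseteq C$ a finite Galois extension of $K$ with group $\Gamma=\mathrm{Gal}(L/K)$. An affine variety is a Zariski closed subset of some $C^n$ (irreducibility is not required); it is defined over a subfield $F$ of $C$ if its ideal in $C[x_1,\dots,x_n]$ is generated by polynomials with coefficients in $F$. A rational map, given by quotients of polynomials whose denominators are non-zero on a Zariski dense subset of the source, is defined over $F$ if these polynomials can be chosen with coefficients in $F$; equality of rational maps means equality on a dense subset. A birational isomorphism is a rational map with a two-sided rational inverse; a biregular isomorphism is a bijective polynomial map whose inverse is polynomial. For $\sigma\in\Gamma$, $X^\sigma$ and $f^\sigma$ denote the variety and the map obtained by applying $\sigma$ to the coefficients. Let $X\subseteq C^n$ be an affine variety defined over $L$, and let $\{f_\sigma\}_{\sigma\in\Gamma}$ be a Galois descent datum for $X$: birational isomorphisms $f_\sigma:X\to X^\sigma$ defined over $L$ with $f_{\sigma\tau}=f_\tau^\sigma\circ f_\sigma$ for all $\sigma,\tau\in\Gamma$. Then: 1. There are an affine variety $Y\subseteq C^N$ defined over $K$ and a birational isomorphism $R:X\to Y$, with $R$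 and $R^{-1}$ defined over $L$, such that $R=R^\sigma\circ f_\sigma$ for every $\sigma\in\Gamma$. If $X$ is irreducible, so is $Y$. If every $f_\sigma$ is polynomial (in particular, if every $f_\sigma$ is biregular), then $R$ is a biregular isomorphism, given together with its inverse by polynomials over $L$. 2. If $R:X\to Y$ and $\widehat R:X\to\widehat Y$ are birational isomorphisms defined over $L$ onto affine varieties $Y,\widehat Y$ defined over $K$, with $R=R^\sigma\circ f_\sigma$ and $\widehat R=\widehat R^\sigma\circ f_\sigma$ for every $\sigma\in\Gamma$, then there is a birational isomorphism $J:Y\to\widehat Y$, with $J$ and $J^{-1}$ defined over $K$, such that $\widehat R=J\circ R$. -/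

import Mathlib

noncomputable section

namespace WeilDescent

open MvPolynomial

/-- For `S ⊆ X` this says that `S` is Zariski dense in `X`: every polynomial vanishing on `S`
vanishes on `X`. -/
def DenseIn {C : Type*} [Field C] {n : ℕ} (S X : Set (Fin n → C)) : Prop :=
  ∀ p : MvPolynomial (Fin n) C, (∀ x ∈ S, aeval x p = 0) → ∀ x ∈ X, aeval x p = 0

/-- `X ⊆ Cⁿ` is an affine algebraic variety (a Zariski closed set, not necessarily irreducible)
whose ideal in `C[x₁, …, xₙ]` is generated by polynomials with coefficients in `F`. -/
def IsDefinedOver (F : Type*) {C : Type*} [Field F] [Field C] [Algebra F C] {n : ℕ}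
    (X : Set (Fin n → C)) : Prop :=
  zeroLocus C (vanishingIdeal C X) = X ∧
    ∃ S : Set (MvPolynomial (Fin n) F),
      vanishingIdeal C X = Ideal.span (MvPolynomial.map (algebraMap F C) '' S)

/-- The conjugate variety `X^σ`: the common zeros of the polynomials `P^σ`, where `P` runs over
the polynomials with coefficients in `L` that vanish on `X`. -/
def conjVariety {K L C : Type*} [Field K] [Field L] [Field C] [Algebra K L] [Algebra L C] {n : ℕ}
    (σ : L ≃ₐ[K] L) (X : Set (Fin n → C)) : Set (Fin n → C) :=
  {x | ∀ P ∈ vanishingIdeal L X, aeval x (MvPolynomial.map (σ : L →+* L) P) = 0}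

/-- A representative `(r₁/s, …, rₘ/s)` of a rational map to `m`-space with coefficients in `F`,
the denominator being common to all coordinates. -/
structure RatMap (F : Type*) [Field F] (n m : ℕ) where
  num : Fin m → MvPolynomial (Fin n) F
  den : MvPolynomial (Fin n) F

namespace RatMap

variable {F : Type*} [Field F] {n m l : ℕ}

/-- The points at which the denominator does not vanish. -/
def dom (C : Type*) [Field C] [Algebra F C] (f : RatMap F n m) : Set (Fin n → C) :=
  {x | aeval x f.den ≠ 0}

/-- The value of the map at a point (meaningful on `f.dom C`). -/
def eval {C : Type*} [Field C] [Algebra F C] (f : RatMap F n m) (x : Fin n → C) : Fin m → C :=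
  fun j => aeval x (f.num j) / aeval x f.den

/-- The conjugate map `f^σ`: apply `σ` to all coefficients. -/
def conj {K L : Type*} [Field K] [Field L] [Algebra K L] (σ : L ≃ₐ[K] L) (f : RatMap L n m) :
    RatMap L n m where
  num j := MvPolynomial.map (σ : L →+* L) (f.num j)
  den := MvPolynomial.map (σ : L →+* L) f.den

/-- `f` is a rational map `X ⇢ Y`: its denominator does not vanish on a dense subset of `X`,
and `f` sends the points of `X` where it does not vanish into `Y`. -/
def IsRationalMap {C : Type*} [Field C] [Algebra F C] (f : RatMap F n m)
    (X : Set (Fin n → C)) (Y : Set (Fin m → C)) : Prop :=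
  DenseIn (X ∩ f.dom C) X ∧ ∀ x ∈ X ∩ f.dom C, f.eval x ∈ Y

/-- `h = g ∘ f` as rational maps on `X`: the composition is defined, and agrees with `h`, on a
dense subset of `X`. -/
def IsComp {F' F'' C : Type*} [Field F'] [Field F''] [Field C] [Algebra F C] [Algebra F' C]
    [Algebra F'' C] (X : Set (Fin n → C)) (h : RatMap F'' n l) (g : RatMap F' m l)
    (f : RatMap F n m) : Prop :=
  DenseIn {x ∈ X | x ∈ h.dom C ∧ x ∈ f.dom C ∧ f.eval x ∈ g.dom C ∧
    h.eval x = g.eval (f.eval x)} X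

/-- The identity map of affine space. -/
def id (F : Type*) [Field F] (n : ℕ) : RatMap F n n where
  num := X
  den := 1

/-- `f : X ⇢ Y` is a birational isomorphism whose inverse has coefficients in `E`. -/
def IsBirational (E : Type*) {C : Type*} [Field E] [Field C] [Algebra F C] [Algebra E C]
    (f : RatMap F n m) (X : Set (Fin n → C)) (Y : Set (Fin m → C)) : Prop :=
  f.IsRationalMap X Y ∧ ∃ g : RatMap E m n, g.IsRationalMap Y X ∧
    IsComp X (RatMap.id E n) g f ∧ IsComp Y (RatMap.id E m) f g

/-- The rational map `f` on `X` is given by polynomials with coefficients in `E`. -/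
def IsPolynomial (E : Type*) {C : Type*} [Field E] [Field C] [Algebra F C] [Algebra E C]
    (f : RatMap F n m) (X : Set (Fin n → C)) : Prop :=
  ∃ p : Fin m → MvPolynomial (Fin n) E, ∀ x ∈ X ∩ f.dom C, f.eval x = fun j => aeval x (p j)

/-- The rational map `f : X ⇢ Y` extends to a biregular isomorphism `X → Y`: it is given by
polynomials which map `X` bijectively onto `Y`, with inverse given by polynomials; all these
polynomials have coefficients in `E`. -/
def IsBiregular (E : Type*) {C : Type*} [Field E] [Field C] [Algebra F C] [Algebra E C]
    (f : RatMap F n m) (X : Set (Fin n → C)) (Y : Set (Fin m → C)) : Prop :=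
  ∃ (p : Fin m → MvPolynomial (Fin n) E) (q : Fin n → MvPolynomial (Fin m) E),
    (∀ x ∈ X ∩ f.dom C, f.eval x = fun j => aeval x (p j)) ∧
    (∀ x ∈ X, (fun j => aeval x (p j)) ∈ Y ∧
      (fun i => aeval (fun j => aeval x (p j)) (q i)) = x) ∧
    (∀ y ∈ Y, (fun i => aeval y (q i)) ∈ X ∧
      (fun j => aeval (fun i => aeval y (q i)) (p j)) = y)

/-- A biregular isomorphism is in particular polynomial. -/
theorem IsBiregular.isPolynomial {E C : Type*} [Field E] [Field C] [Algebra F C] [Algebra E C]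
    {f : RatMap F n m} {X : Set (Fin n → C)} {Y : Set (Fin m → C)}
    (h : f.IsBiregular E X Y) : f.IsPolynomial E X := by
  obtain ⟨p, _, hp, _⟩ := h
  exact ⟨p, hp⟩

end RatMap

/-- A Galois descent datum for `X` with respect to `L/K`: birational isomorphisms
`f σ : X ⇢ X^σ` with coefficients in `L` such that `f (σ τ) = (f τ)^σ ∘ f σ`. -/
def IsDescentDatum {K L C : Type*} [Field K] [Field L] [Field C] [Algebra K L] [Algebra L C]
    {n : ℕ} (X : Set (Fin n → C)) (f : (L ≃ₐ[K] L) → RatMap L n n) : Prop :=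
  (∀ σ, (f σ).IsBirational C X (conjVariety σ X)) ∧
    ∀ σ τ, RatMap.IsComp X (f (σ * τ)) ((f τ).conj σ) (f σ)

/-- `R = R^σ ∘ f σ` on `X` for every `σ`. -/
def IsCompatible {K L C : Type*} [Field K] [Field L] [Field C] [Algebra K L] [Algebra L C]
    {n N : ℕ} (X : Set (Fin n → C)) (f : (L ≃ₐ[K] L) → RatMap L n n) (R : RatMap L n N) : Prop :=
  ∀ σ, RatMap.IsComp X R (R.conj σ) (f σ)

end WeilDescent

end

/-!
Write `Γ` for the Galois group. The proof is a concrete form of Weil restriction followed by Galois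
descent for ideals.

*Existence.* Choose `aₖ, bₖ ∈ L` with `∑ₖ bₖ σ(aₖ) = δ_{σ,1}`, which is possible by non-degeneracy
of the trace form and linear independence of characters (`exists_galois_coordinates`). Let `R` have
the coordinates `R_{ik} = ∑_σ σ(aₖ) (f_σ)ᵢ`, the "traces" of the functions `aₖ xᵢ` for the action of
`Γ` on rational functions given by the descent datum (`traceMap`). The cocycle condition says that
this is compatible with the datum, and since `f₁ = id` one recovers `xᵢ = ∑ₖ bₖ R_{ik}`. So `R` is
birational onto the Zariski closure `Y` of its image, with a *linear* inverse, and it is biregular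
as soon as all `f_σ` are polynomial. The ideal of the image of a compatible map is stable under
coefficientwise `L`-linear functionals `C → L`, because `X` and `R` are defined over `L`, and its
polynomials over `L` are stable under conjugation, because `R = R^σ ∘ f_σ`. Such an ideal is
generated over `K` (`eq_span_map_of_stable`), by traces.

*Uniqueness.* If `R` and `R'` are compatible, so is the map `(R, R')` to the product, and therefore
the graph of `J = R' ∘ R⁻¹` has its ideal generated over `K`. The polynomials `b(y)` which are
denominators of `J` form an ideal of `C[y]`, stable under functionals `C → K`, which contains a
non-zero-divisor modulo the ideal of `Y`. By prime avoidance it then contains a non-zero-divisor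
with coefficients in `K` (`exists_nonvanishing_mem`), and the numerators can be moved to `K` by a
`K`-linear retraction `C → K` (`exists_ratMap_over`).

Since varieties may be reducible, "on a dense subset" is handled through the filter `generic X` of
subsets of `X` containing a dense principal open subset. Equalities of rational maps hold
generically (`RatMap.IsComp.eventually`), and birational maps pull generic sets back to generic sets
(`RatMap.tendsto_generic`).
-/

noncomputable section

namespace WeilDescent

open MvPolynomial

/-! ### Coefficientwise functionals -/

section Coefficients

variable {F C : Type*} [Field F] [Field C] [Algebra F C] {ι : Type*}

/-- Apply an `F`-linear functional `φ : C → F` to all coefficients of a polynomial. -/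
def mapCoeff (φ : C →ₗ[F] F) (p : MvPolynomial ι C) : MvPolynomial ι F :=
  ∑ m ∈ p.support, monomial m (φ (coeff m p))

@[simp]
theorem coeff_mapCoeff (φ : C →ₗ[F] F) (p : MvPolynomial ι C) (m : ι →₀ ℕ) :
    coeff m (mapCoeff φ p) = φ (coeff m p) := by
  classical
  simp +contextual [mapCoeff, coeff_sum, coeff_monomial]

theorem mapCoeff_zero (φ : C →ₗ[F] F) : mapCoeff φ (0 : MvPolynomial ι C) = 0 := by
  ext m; simp

theorem mapCoeff_add (φ : C →ₗ[F] F) (p q : MvPolynomial ι C) :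
    mapCoeff φ (p + q) = mapCoeff φ p + mapCoeff φ q := by
  ext m; simp

theorem mapCoeff_sub (φ : C →ₗ[F] F) (p q : MvPolynomial ι C) :
    mapCoeff φ (p - q) = mapCoeff φ p - mapCoeff φ q := by
  ext m; simp

theorem mapCoeff_C (φ : C →ₗ[F] F) (c : C) :
    mapCoeff φ (MvPolynomial.C c : MvPolynomial ι C) = MvPolynomial.C (φ c) := by
  classical
  ext m
  simp only [coeff_mapCoeff, coeff_C]
  split_ifs <;> simp

/-- `mapCoeff φ` is linear over the polynomials with coefficients in `F`. -/
theorem mapCoeff_mul_map (φ : C →ₗ[F] F) (p : MvPolynomial ι C) (q : MvPolynomial ι F) :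
    mapCoeff φ (p * map (algebraMap F C) q) = mapCoeff φ p * q := by
  classical
  ext m
  simp only [coeff_mapCoeff, coeff_mul, map_sum, coeff_map]
  refine Finset.sum_congr rfl fun x _ => ?_
  rw [mul_comm, ← Algebra.smul_def, map_smul, smul_eq_mul, mul_comm]

theorem mapCoeff_mul_X (φ : C →ₗ[F] F) (p : MvPolynomial ι C) (i : ι) :
    mapCoeff φ (p * X i) = mapCoeff φ p * X i := by
  simpa using mapCoeff_mul_map φ p (X i)

theorem mapCoeff_map (φ : C →ₗ[F] F) (hφ : φ 1 = 1) (q : MvPolynomial ι F) :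
    mapCoeff φ (map (algebraMap F C) q) = q := by
  ext m
  rw [coeff_mapCoeff, coeff_map, Algebra.algebraMap_eq_smul_one, map_smul, hφ, smul_eq_mul,
    mul_one]

theorem mapCoeff_rename {κ : Type*} (e : ι → κ) (φ : C →ₗ[F] F) (p : MvPolynomial ι C) :
    mapCoeff φ (rename e p) = rename e (mapCoeff φ p) := by
  induction p using MvPolynomial.induction_on with
  | C a => simp [mapCoeff_C]
  | add p q hp hq => simp [mapCoeff_add, hp, hq]
  | mul_X p i hp => simp [mapCoeff_mul_X, hp]

/-- A field extension `C / F` has an `F`-linear retraction `C → F`. -/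
theorem exists_retraction (F C : Type*) [Field F] [Field C] [Algebra F C] :
    ∃ φ : C →ₗ[F] F, φ 1 = 1 := by
  obtain ⟨φ, hφ⟩ := (Algebra.linearMap F C).exists_leftInverse_of_injective
    (LinearMap.ker_eq_bot.2 (algebraMap F C).injective)
  exact ⟨φ, by simpa using LinearMap.congr_fun hφ 1⟩

/-- A polynomial is a linear combination of its images under coefficientwise functionals, namely
the coordinate functionals of a basis. -/
theorem mem_of_forall_mapCoeff_mem (V : Ideal (MvPolynomial ι C)) (p : MvPolynomial ι C)
    (h : ∀ φ : C →ₗ[F] F, map (algebraMap F C) (mapCoeff φ p) ∈ V) : p ∈ V := by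
  classical
  let b := Module.Basis.ofVectorSpace F C
  let s := p.support.biUnion fun m => (b.repr (coeff m p)).support
  have hp : p = ∑ i ∈ s, MvPolynomial.C (b i) *
      map (algebraMap F C) (mapCoeff (b.coord i) p) := by
    ext m
    simp only [coeff_sum, coeff_C_mul, coeff_map, coeff_mapCoeff, Module.Basis.coord_apply]
    by_cases hm : m ∈ p.support
    · conv_lhs => rw [← b.linearCombination_repr (coeff m p), Finsupp.linearCombination_apply]
      rw [Finsupp.sum_of_support_subset (s := s) _ (Finset.subset_biUnion_of_mem
        (fun m => (b.repr (coeff m p)).support) hm) _ (by simp)]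
      exact Finset.sum_congr rfl fun i _ => by rw [Algebra.smul_def, mul_comm]
    · simp [notMem_support_iff.1 hm]
  rw [hp]
  exact V.sum_mem fun i _ => V.mul_mem_left _ (h _)

/-- An ideal generated by polynomials over `F` is stable under coefficientwise functionals. -/
theorem map_mapCoeff_mem_span (S : Set (MvPolynomial ι F)) (φ : C →ₗ[F] F)
    {p : MvPolynomial ι C} (hp : p ∈ Ideal.span (map (algebraMap F C) '' S)) :
    map (algebraMap F C) (mapCoeff φ p) ∈ Ideal.span (map (algebraMap F C) '' S) := by
  suffices h : ∀ c : MvPolynomial ι C, map (algebraMap F C) (mapCoeff φ (c * p)) ∈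
      Ideal.span (map (algebraMap F C) '' S) by simpa using h 1
  induction hp using Submodule.span_induction with
  | mem x hx =>
    obtain ⟨q, hq, rfl⟩ := hx
    intro c
    rw [mapCoeff_mul_map, map_mul]
    exact Ideal.mul_mem_left _ _ (Ideal.subset_span ⟨q, hq, rfl⟩)
  | zero => intro c; simp [mapCoeff_zero]
  | add x y _ _ hx hy =>
    intro c
    rw [mul_add, mapCoeff_add, map_add]
    exact Ideal.add_mem _ (hx c) (hy c)
  | smul a x _ hx =>
    intro c
    rw [smul_eq_mul, ← mul_assoc]
    exact hx _

theorem IsDefinedOver.map_mapCoeff_mem {n : ℕ} {X : Set (Fin n → C)} (hX : IsDefinedOver F X)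
    (φ : C →ₗ[F] F) {p : MvPolynomial (Fin n) C} (hp : p ∈ vanishingIdeal C X) :
    map (algebraMap F C) (mapCoeff φ p) ∈ vanishingIdeal C X := by
  obtain ⟨-, S, hS⟩ := hX
  rw [hS] at hp ⊢
  exact map_mapCoeff_mem_span S φ hp

theorem map_mem_vanishingIdeal_iff {n : ℕ} {X : Set (Fin n → C)} {p : MvPolynomial (Fin n) F} :
    map (algebraMap F C) p ∈ vanishingIdeal C X ↔ p ∈ vanishingIdeal F X := by
  simp [mem_vanishingIdeal_iff, aeval_map_algebraMap]

end Coefficients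

/-! ### Galois descent for ideals -/

section Galois

variable {K L C : Type*} [Field K] [Field L] [Field C] [Algebra K L] [Algebra K C] [Algebra L C]
  [IsScalarTower K L C] [FiniteDimensional K L] [IsGalois K L]

open Classical in
/-- Dual bases for the trace form, as orthogonality relations over the Galois group. -/
theorem exists_galois_coordinates (K L : Type*) [Field K] [Field L] [Algebra K L]
    [FiniteDimensional K L] [IsGalois K L] :
    ∃ (d : ℕ) (a b : Fin d → L), ∀ σ : L ≃ₐ[K] L,
      ∑ k, b k * σ (a k) = if σ = 1 then 1 else 0 := by
  classical
  let e := Module.finBasis K L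
  have hB := traceForm_nondegenerate K L
  let e' := (Algebra.traceForm K L).dualBasis hB e
  refine ⟨_, e, e', fun σ => ?_⟩
  -- `x = ∑ tr (x eₖ) e'ₖ` is a linear relation between the characters `σ` of `Lˣ`.
  have key : ∀ x : L, ∑ τ : L ≃ₐ[K] L, (∑ k, e' k * τ (e k)) * τ x = x := by
    intro x
    conv_rhs => rw [← e'.sum_repr x]
    simp only [e', LinearMap.BilinForm.dualBasis_repr_apply, Algebra.traceForm_apply,
      Algebra.smul_def, trace_eq_sum_automorphisms, map_mul, Finset.sum_mul]
    rw [Finset.sum_comm]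
    refine Finset.sum_congr rfl fun k _ => Finset.sum_congr rfl fun τ _ => ?_
    ring
  have hli : LinearIndependent L (fun (τ : L ≃ₐ[K] L) => (τ : L → L)) := by
    have h := (linearIndependent_monoidHom L L).comp
      (fun τ : L ≃ₐ[K] L => ((τ : L →+* L) : L →* L)) ?_
    · exact h
    · intro τ τ' h
      ext x
      exact DFunLike.congr_fun h x
  have hsum := (Fintype.linearIndependent_iff.1 hli)
    (fun τ => (∑ k, e' k * τ (e k)) - if τ = 1 then 1 else 0) ?_ σ
  · exact sub_eq_zero.1 hsum
  · ext x
    simp [sub_mul, Finset.sum_sub_distrib, key x]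

/-- A polynomial over `L` fixed by the Galois group has coefficients in `K`. -/
theorem exists_map_eq_of_forall_map_eq {ι : Type*} (p : MvPolynomial ι L)
    (h : ∀ σ : L ≃ₐ[K] L, map (σ : L →+* L) p = p) : ∃ q, map (algebraMap K L) q = p := by
  change p ∈ Set.range (map (algebraMap K L))
  rw [mem_range_map_iff_coeffs_subset]
  intro c hc
  obtain ⟨m, -, rfl⟩ := mem_coeffs_iff.1 hc
  refine (IsGalois.mem_range_algebraMap_iff_fixed _).2 fun σ => ?_
  exact (coeff_map _ _ _).symm.trans (congrArg (coeff m) (h σ))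

/-- **Galois descent for ideals**: an ideal of `C[x]` stable under coefficientwise functionals
`C → L`, whose polynomials over `L` are stable under `Gal(L/K)`, is generated over `K`. -/
theorem eq_span_map_of_stable {ι : Type*} (V : Ideal (MvPolynomial ι C))
    (h₁ : ∀ p ∈ V, ∀ φ : C →ₗ[L] L, map (algebraMap L C) (mapCoeff φ p) ∈ V)
    (h₂ : ∀ p : MvPolynomial ι L, map (algebraMap L C) p ∈ V →
      ∀ σ : L ≃ₐ[K] L, map (algebraMap L C) (map (σ : L →+* L) p) ∈ V) :
    ∃ S : Set (MvPolynomial ι K), V = Ideal.span (map (algebraMap K C) '' S) := by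
  classical
  refine ⟨{p | map (algebraMap K C) p ∈ V}, le_antisymm (fun p hp => ?_) ?_⟩
  swap
  · rw [Ideal.span_le]
    rintro _ ⟨q, hq, rfl⟩
    exact hq
  refine mem_of_forall_mapCoeff_mem (F := L) _ p fun φ => ?_
  obtain ⟨d, a, b, hab⟩ := exists_galois_coordinates K L
  set q := mapCoeff φ p with hq
  have hqV : map (algebraMap L C) q ∈ V := h₁ p hp φ
  -- The traces `t k` of `aₖ q` are defined over `K`, and `q = ∑ bₖ (t k)`.
  let t : Fin d → MvPolynomial ι L := fun k =>
    ∑ σ : L ≃ₐ[K] L, MvPolynomial.C (σ (a k)) * map (σ : L →+* L) q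
  have ht : ∀ k, ∃ r, map (algebraMap K L) r = t k := fun k => by
    refine exists_map_eq_of_forall_map_eq _ fun τ => ?_
    simp only [t, map_sum, map_mul, map_C, map_map]
    refine Fintype.sum_equiv (Equiv.mulLeft τ) _ _ fun σ => ?_
    rfl
  choose r hr using ht
  have hrV : ∀ k, map (algebraMap K C) (r k) ∈ V := fun k => by
    rw [IsScalarTower.algebraMap_eq K L C, ← map_map, hr]
    simp only [t, map_sum, map_mul]
    exact V.sum_mem fun σ _ => V.mul_mem_left _ (h₂ q hqV σ)
  have hqt : q = ∑ k, MvPolynomial.C (b k) * t k := by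
    simp only [t, Finset.mul_sum, ← mul_assoc, ← map_mul]
    rw [Finset.sum_comm]
    simp only [← Finset.sum_mul, ← map_sum, hab]
    simp only [apply_ite MvPolynomial.C, map_one, map_zero, ite_mul, one_mul, zero_mul,
      Finset.sum_ite_eq', Finset.mem_univ, if_true]
    exact (map_id q).symm
  rw [hqt, map_sum]
  refine Ideal.sum_mem _ fun k _ => ?_
  rw [map_mul, ← hr, map_map, ← IsScalarTower.algebraMap_eq]
  exact Ideal.mul_mem_left _ _ (Ideal.subset_span ⟨_, hrV k, rfl⟩)

end Galois

/-! ### Generic points of a variety -/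

section Generic

variable {C : Type*} [Field C] {n : ℕ} {X : Set (Fin n → C)}

/-- The filter of generic subsets of `X`: those containing a principal open subset `{s ≠ 0}` of
`X` which is Zariski dense, i.e. such that `s` is a non-zero-divisor modulo the ideal of `X`. -/
def generic (X : Set (Fin n → C)) : Filter (Fin n → C) where
  sets := {U | ∃ s : MvPolynomial (Fin n) C,
    (∀ p, s * p ∈ vanishingIdeal C X → p ∈ vanishingIdeal C X) ∧
      ∀ x ∈ X, aeval x s ≠ 0 → x ∈ U}
  univ_sets := ⟨1, by simp, by simp⟩
  sets_of_superset := by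
    rintro U V ⟨s, hs, hU⟩ hUV
    exact ⟨s, hs, fun x hx h => hUV (hU x hx h)⟩
  inter_sets := by
    rintro U V ⟨s, hs, hU⟩ ⟨t, ht, hV⟩
    refine ⟨s * t, fun p hp => ht p (hs _ (by rwa [mul_assoc] at hp)), fun x hx h => ?_⟩
    rw [map_mul] at h
    exact ⟨hU x hx (left_ne_zero_of_mul h), hV x hx (right_ne_zero_of_mul h)⟩

theorem eventually_generic {P : (Fin n → C) → Prop} :
    (∀ᶠ x in generic X, P x) ↔ ∃ s : MvPolynomial (Fin n) C,
      (∀ p, s * p ∈ vanishingIdeal C X → p ∈ vanishingIdeal C X) ∧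
        ∀ x ∈ X, aeval x s ≠ 0 → P x :=
  Iff.rfl

theorem eventually_mem_generic : ∀ᶠ x in generic X, x ∈ X :=
  eventually_generic.2 ⟨1, by simp, fun _ hx _ => hx⟩

theorem mem_vanishingIdeal_of_eventually {p : MvPolynomial (Fin n) C}
    (h : ∀ᶠ x in generic X, aeval x p = 0) : p ∈ vanishingIdeal C X := by
  obtain ⟨s, hs, h⟩ := eventually_generic.1 h
  refine hs p fun x hx => ?_
  rw [map_mul]
  by_cases hsx : aeval x s = 0
  · rw [hsx, zero_mul]
  · rw [h x hx hsx, mul_zero]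

theorem denseIn_of_eventually {S : Set (Fin n → C)} (h : ∀ᶠ x in generic X, x ∈ S) :
    DenseIn S X :=
  fun _ hp => mem_vanishingIdeal_of_eventually (h.mono hp)

/-- A dense set contained in a principal open set makes the latter dense. -/
theorem eventually_ne_of_denseIn {S : Set (Fin n → C)} (h : DenseIn S X) (hS : S ⊆ X)
    {s : MvPolynomial (Fin n) C} (hs : ∀ x ∈ S, aeval x s ≠ 0) :
    ∀ᶠ x in generic X, aeval x s ≠ 0 := by
  refine eventually_generic.2 ⟨s, fun p hp => h p fun x hx => ?_, fun _ _ h => h⟩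
  have := hp x (hS hx)
  rw [map_mul] at this
  exact (mul_eq_zero.1 this).resolve_left (hs x hx)

theorem mul_mem_vanishingIdeal_cancel {s p : MvPolynomial (Fin n) C}
    (hs : ∀ᶠ x in generic X, aeval x s ≠ 0) (hp : s * p ∈ vanishingIdeal C X) :
    p ∈ vanishingIdeal C X := by
  refine mem_vanishingIdeal_of_eventually ?_
  filter_upwards [hs, eventually_mem_generic] with x hx hxX
  have := hp x hxX
  rw [map_mul] at this
  exact (mul_eq_zero.1 this).resolve_left hx

end Generic

/-! ### Rational maps at generic points -/

namespace RatMap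

variable {F E E' C : Type*} [Field F] [Field E] [Field E'] [Field C] [Algebra F C] [Algebra E C]
  [Algebra E' C] {n m l : ℕ} {X : Set (Fin n → C)} {Y : Set (Fin m → C)}

theorem num_eq {f : RatMap F n m} {x : Fin n → C} (hx : x ∈ f.dom C) (j : Fin m) :
    aeval x (f.num j) = aeval x f.den * f.eval x j :=
  (mul_div_cancel₀ _ hx).symm

/-- Clearing denominators in `p ∘ f`, compatibly with coefficientwise functionals. -/
theorem exists_clear_denominators (f : RatMap F n m) (p : MvPolynomial (Fin m) C) :
    ∃ (q : MvPolynomial (Fin n) C) (N : ℕ),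
      (∀ x ∈ f.dom C, aeval x q = aeval x f.den ^ N * aeval (f.eval x) p) ∧
      ∀ φ : C →ₗ[F] F, ∀ x ∈ f.dom C, aeval x (mapCoeff φ q) =
        aeval x f.den ^ N * aeval (f.eval x) (mapCoeff φ p) := by
  induction p using MvPolynomial.induction_on with
  | C a => exact ⟨MvPolynomial.C a, 0, by simp, by simp [mapCoeff_C]⟩
  | add p₁ p₂ h₁ h₂ =>
    obtain ⟨q₁, N₁, h₁, h₁'⟩ := h₁
    obtain ⟨q₂, N₂, h₂, h₂'⟩ := h₂
    refine ⟨q₁ * map (algebraMap F C) (f.den ^ N₂) + q₂ * map (algebraMap F C) (f.den ^ N₁),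
      N₁ + N₂, fun x hx => ?_, fun φ x hx => ?_⟩
    · simp only [map_add, map_mul, h₁ x hx, h₂ x hx, aeval_map_algebraMap, map_pow]
      ring
    · rw [mapCoeff_add, mapCoeff_add, mapCoeff_mul_map, mapCoeff_mul_map]
      simp only [map_add, map_mul, h₁' φ x hx, h₂' φ x hx, map_pow]
      ring
  | mul_X p i h =>
    obtain ⟨q, N, h, h'⟩ := h
    refine ⟨q * map (algebraMap F C) (f.num i), N + 1, fun x hx => ?_, fun φ x hx => ?_⟩
    · simp only [map_mul, h x hx, aeval_map_algebraMap, aeval_X, num_eq hx]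
      ring
    · simp only [mapCoeff_mul_map, mapCoeff_mul_X, map_mul, h' φ x hx, aeval_X, num_eq hx]
      ring

/-- Clearing denominators in `p ∘ f`, by a polynomial `q` and an exponent `N` which serve all
conjugates simultaneously. -/
theorem exists_clear_denominators_conj {K : Type*} [Field K] [Algebra K F] (f : RatMap F n m)
    (p : MvPolynomial (Fin m) F) :
    ∃ (q : MvPolynomial (Fin n) F) (N : ℕ), ∀ σ : F ≃ₐ[K] F, ∀ x ∈ (f.conj σ).dom C,
      aeval x (map (σ : F →+* F) q) =
        aeval x (f.conj σ).den ^ N * aeval ((f.conj σ).eval x) (map (σ : F →+* F) p) := by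
  induction p using MvPolynomial.induction_on with
  | C a => exact ⟨MvPolynomial.C a, 0, by simp⟩
  | add p₁ p₂ h₁ h₂ =>
    obtain ⟨q₁, N₁, h₁⟩ := h₁
    obtain ⟨q₂, N₂, h₂⟩ := h₂
    refine ⟨q₁ * f.den ^ N₂ + q₂ * f.den ^ N₁, N₁ + N₂, fun σ x hx => ?_⟩
    have hden : map (σ : F →+* F) f.den = (f.conj σ).den := rfl
    simp only [map_add, map_mul, h₁ σ x hx, h₂ σ x hx, map_pow, hden]
    ring
  | mul_X p i h =>
    obtain ⟨q, N, h⟩ := h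
    refine ⟨q * f.num i, N + 1, fun σ x hx => ?_⟩
    have hnum : map (σ : F →+* F) (f.num i) = (f.conj σ).num i := rfl
    simp only [map_mul, h σ x hx, map_X, aeval_X, hnum, num_eq hx]
    ring

theorem den_pow_ne_zero {f : RatMap F n m} {x : Fin n → C} (hx : x ∈ f.dom C) (N : ℕ) :
    aeval x f.den ^ N ≠ 0 :=
  pow_ne_zero N hx

/-- A polynomial vanishing at the generic value of `f` vanishes at every value of `f`. -/
theorem aeval_eval_eq_zero_of_eventually {f : RatMap F n m} {p : MvPolynomial (Fin m) C}
    (h : ∀ᶠ x in generic X, x ∈ f.dom C → aeval (f.eval x) p = 0) {x : Fin n → C} (hxX : x ∈ X)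
    (hx : x ∈ f.dom C) : aeval (f.eval x) p = 0 := by
  obtain ⟨q, N, hq, -⟩ := f.exists_clear_denominators p
  -- `den * q` vanishes generically on `X`, also where `den` is zero.
  have hmem : map (algebraMap F C) f.den * q ∈ vanishingIdeal C X := by
    refine mem_vanishingIdeal_of_eventually (h.mono fun y hy => ?_)
    rw [map_mul, aeval_map_algebraMap]
    by_cases hyd : y ∈ f.dom C
    · rw [hq y hyd, hy hyd, mul_zero, mul_zero]
    · rw [not_not.1 hyd, zero_mul]
  have := hmem x hxX
  rw [map_mul, aeval_map_algebraMap, hq x hx] at this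
  exact (mul_eq_zero.1 ((mul_eq_zero.1 this).resolve_left hx)).resolve_left (den_pow_ne_zero hx N)

theorem eventually_dom {f : RatMap F n m} (hf : DenseIn (X ∩ f.dom C) X) :
    ∀ᶠ x in generic X, x ∈ f.dom C := by
  have := eventually_ne_of_denseIn hf Set.inter_subset_left (s := map (algebraMap F C) f.den)
    fun x hx => by rw [aeval_map_algebraMap]; exact hx.2
  simp only [aeval_map_algebraMap] at this
  exact this

/-- An equality `h = g ∘ f` of rational maps holds on a dense principal open set, not only on the
dense set required by the definition: its domain is such a set, and there it is an equality of
polynomials after clearing denominators. -/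
theorem IsComp.eventually {h : RatMap F n l} {g : RatMap E m l} {f : RatMap E' n m}
    (H : IsComp X h g f) : ∀ᶠ x in generic X, x ∈ h.dom C ∧ x ∈ f.dom C ∧ f.eval x ∈ g.dom C ∧
      h.eval x = g.eval (f.eval x) := by
  have hsub : {x ∈ X | x ∈ h.dom C ∧ x ∈ f.dom C ∧ f.eval x ∈ g.dom C ∧
    h.eval x = g.eval (f.eval x)} ⊆ X := fun _ hx => hx.1
  have hh : ∀ᶠ x in generic X, x ∈ h.dom C := eventually_dom fun p hp =>
    H p fun x hx => hp x ⟨hx.1, hx.2.1⟩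
  have hf : ∀ᶠ x in generic X, x ∈ f.dom C := eventually_dom fun p hp =>
    H p fun x hx => hp x ⟨hx.1, hx.2.2.1⟩
  obtain ⟨d, N, hd, -⟩ := f.exists_clear_denominators (map (algebraMap E C) g.den)
  have hdne := eventually_ne_of_denseIn H hsub (s := d) fun x hx => by
    rw [hd x hx.2.2.1, aeval_map_algebraMap]
    exact mul_ne_zero (den_pow_ne_zero hx.2.2.1 N) hx.2.2.2.1
  have hnum : ∀ j, ∀ᶠ x in generic X, x ∈ f.dom C →
      aeval x (h.num j) * aeval (f.eval x) g.den = aeval (f.eval x) (g.num j) * aeval x h.den := by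
    intro j
    obtain ⟨e, M, he, -⟩ := f.exists_clear_denominators (map (algebraMap E C) (g.num j))
    have hmem : map (algebraMap F C) (h.num j) * d * map (algebraMap E' C) (f.den ^ M) -
        map (algebraMap F C) h.den * e * map (algebraMap E' C) (f.den ^ N) ∈
        vanishingIdeal C X := by
      refine H _ fun x hx => ?_
      obtain ⟨hxX, hxh, hxf, hxg, hx⟩ := hx
      simp only [map_sub, map_mul, aeval_map_algebraMap, hd x hxf, he x hxf, num_eq hxg, num_eq hxh,
        map_pow, hx]
      ring
    filter_upwards [eventually_mem_generic] with x hxX hxf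
    have := hmem x hxX
    simp only [map_sub, map_mul, aeval_map_algebraMap, hd x hxf, he x hxf, map_pow] at this
    refine sub_eq_zero.1 ((mul_eq_zero.1 (?_ : aeval x f.den ^ (N + M) * _ = 0)).resolve_left
      (den_pow_ne_zero hxf _))
    rw [← this]
    ring
  filter_upwards [hh, hf, hdne, Filter.eventually_all.2 hnum] with x hxh hxf hxd hx
  rw [hd x hxf, aeval_map_algebraMap] at hxd
  have hxg : f.eval x ∈ g.dom C := right_ne_zero_of_mul hxd
  refine ⟨hxh, hxf, hxg, funext fun j => ?_⟩
  exact (div_eq_div_iff hxh hxg).2 (hx j hxf)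

theorem isComp_of_eventually {h : RatMap F n l} {g : RatMap E m l} {f : RatMap E' n m}
    (H : ∀ᶠ x in generic X, x ∈ h.dom C ∧ x ∈ f.dom C ∧ f.eval x ∈ g.dom C ∧
      h.eval x = g.eval (f.eval x)) : IsComp X h g f :=
  denseIn_of_eventually (eventually_mem_generic.and H)

@[simp]
theorem mem_dom_id (x : Fin n → C) : x ∈ (RatMap.id F n).dom C := by
  simp [dom, RatMap.id]

@[simp]
theorem eval_id (x : Fin n → C) : (RatMap.id F n).eval x = x := by
  ext j; simp [eval, RatMap.id]

/-- A birational isomorphism pulls generic sets back to generic sets: if `s` is a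
non-zero-divisor on `Y` and `p · (s ∘ f) = 0` on `X`, then `(p ∘ g) · s = 0` on `Y` for the
inverse `g`, hence `p ∘ g = 0` and `p = p ∘ g ∘ f = 0`. -/
theorem tendsto_generic {A B : Type*} [Field A] [Field B] [Algebra A C] [Algebra B C]
    {f : RatMap F n m} {g : RatMap E m n} (hf : f.IsRationalMap X Y)
    (hg : g.IsRationalMap Y X) (hgf : IsComp X (RatMap.id A n) g f)
    (hfg : IsComp Y (RatMap.id B m) f g) :
    Filter.Tendsto f.eval (generic X) (generic Y) := by
  intro U hU
  obtain ⟨s, hs, hU⟩ := eventually_generic.1 hU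
  obtain ⟨t, N, ht, -⟩ := f.exists_clear_denominators s
  have hfd := eventually_dom hf.1
  have htne : ∀ᶠ x in generic X, aeval x t ≠ 0 := by
    refine eventually_generic.2 ⟨t, fun p hp => ?_, fun _ _ h => h⟩
    have hpg : ∀ᶠ y in generic Y, y ∈ g.dom C → aeval (g.eval y) p = 0 := by
      obtain ⟨q, M, hq, -⟩ := g.exists_clear_denominators p
      have hsq : q ∈ vanishingIdeal C Y := by
        refine hs q (mem_vanishingIdeal_of_eventually ?_)
        filter_upwards [hfg.eventually, eventually_mem_generic] with y hy hyY
        obtain ⟨-, hyg, hyf, hy⟩ := hy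
        rw [eval_id] at hy
        have := hp _ (hg.2 y ⟨hyY, hyg⟩)
        rw [map_mul, ht _ hyf, ← hy] at this
        rw [map_mul, hq y hyg]
        rcases mul_eq_zero.1 this with h | h
        · rw [(mul_eq_zero.1 h).resolve_left (den_pow_ne_zero hyf N), zero_mul]
        · rw [h, mul_zero, mul_zero]
      filter_upwards [eventually_mem_generic] with y hyY hyg
      have := hsq y hyY
      rw [hq y hyg] at this
      exact (mul_eq_zero.1 this).resolve_left (den_pow_ne_zero hyg M)
    refine mem_vanishingIdeal_of_eventually ?_
    filter_upwards [hgf.eventually, eventually_mem_generic] with x hx hxX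
    obtain ⟨-, hxf, hxg, hx⟩ := hx
    rw [eval_id] at hx
    rw [hx]
    exact aeval_eval_eq_zero_of_eventually hpg (hf.2 x ⟨hxX, hxf⟩) hxg
  change ∀ᶠ x in generic X, f.eval x ∈ U
  filter_upwards [htne, hfd, eventually_mem_generic] with x hxt hxf hxX
  rw [ht x hxf] at hxt
  exact hU _ (hf.2 x ⟨hxX, hxf⟩) (right_ne_zero_of_mul hxt)

end RatMap

/-! ### Images of rational maps -/

namespace RatMap

section Image

variable {F C : Type*} [Field F] [Field C] [Algebra F C] {n m l : ℕ} {X : Set (Fin n → C)}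

/-- The set of values of `f` at the points of `X` where the denominator does not vanish. -/
def image (f : RatMap F n m) (X : Set (Fin n → C)) : Set (Fin m → C) :=
  f.eval '' (X ∩ f.dom C)

theorem mem_vanishingIdeal_image {f : RatMap F n m} {p : MvPolynomial (Fin m) C}
    (h : ∀ᶠ x in generic X, x ∈ f.dom C → aeval (f.eval x) p = 0) :
    p ∈ vanishingIdeal C (f.image X) := by
  rintro _ ⟨x, ⟨hxX, hx⟩, rfl⟩
  exact aeval_eval_eq_zero_of_eventually h hxX hx

theorem map_mapCoeff_mem_vanishingIdeal_image (hX : IsDefinedOver F X) {f : RatMap F n m}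
    (hf : DenseIn (X ∩ f.dom C) X) (φ : C →ₗ[F] F) {p : MvPolynomial (Fin m) C}
    (hp : p ∈ vanishingIdeal C (f.image X)) :
    map (algebraMap F C) (mapCoeff φ p) ∈ vanishingIdeal C (f.image X) := by
  obtain ⟨q, N, hq, hq'⟩ := f.exists_clear_denominators p
  have hqX : q ∈ vanishingIdeal C X := hf _ fun x hx => by
    rw [hq x hx.2, hp _ ⟨x, hx, rfl⟩, mul_zero]
  rintro _ ⟨x, ⟨hxX, hx⟩, rfl⟩
  have := hX.map_mapCoeff_mem φ hqX x hxX
  rw [aeval_map_algebraMap, hq' φ x hx] at this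
  rw [aeval_map_algebraMap]
  exact (mul_eq_zero.1 this).resolve_left (den_pow_ne_zero hx N)

/-- The ideal of the image of `f` consists of the polynomials `p` with `p ∘ f = 0`, so it is prime
if the ideal of `X` is. -/
theorem isPrime_vanishingIdeal_image {f : RatMap F n m} (hf : DenseIn (X ∩ f.dom C) X)
    (hX : (vanishingIdeal C X).IsPrime) : (vanishingIdeal C (f.image X)).IsPrime := by
  refine ⟨fun htop => hX.ne_top ?_, fun {p₁ p₂} hp => ?_⟩
  · rw [Ideal.eq_top_iff_one] at htop ⊢
    refine hf 1 fun x hx => ?_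
    simpa using htop _ ⟨x, hx, rfl⟩
  · obtain ⟨q₁, N₁, hq₁, -⟩ := f.exists_clear_denominators p₁
    obtain ⟨q₂, N₂, hq₂, -⟩ := f.exists_clear_denominators p₂
    have hq : q₁ * q₂ ∈ vanishingIdeal C X := hf _ fun x hx => by
      have := hp _ ⟨x, hx, rfl⟩
      rw [map_mul] at this
      rw [map_mul, hq₁ x hx.2, hq₂ x hx.2, mul_mul_mul_comm, this, mul_zero]
    refine (hX.mem_or_mem hq).imp (fun h => ?_) fun h => ?_
    · rintro _ ⟨x, hx, rfl⟩
      exact (mul_eq_zero.1 ((hq₁ x hx.2).symm.trans (h x hx.1))).resolve_left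
        (den_pow_ne_zero hx.2 N₁)
    · rintro _ ⟨x, hx, rfl⟩
      exact (mul_eq_zero.1 ((hq₂ x hx.2).symm.trans (h x hx.1))).resolve_left
        (den_pow_ne_zero hx.2 N₂)

/-- The rational map `(f, g)` to the product of affine spaces. -/
def append (f : RatMap F n m) (g : RatMap F n l) : RatMap F n (m + l) where
  num := Fin.append (fun i => f.num i * g.den) (fun j => g.num j * f.den)
  den := f.den * g.den

theorem mem_dom_append {f : RatMap F n m} {g : RatMap F n l} {x : Fin n → C} :
    x ∈ (f.append g).dom C ↔ x ∈ f.dom C ∧ x ∈ g.dom C := by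
  simp [dom, append]

theorem eval_append {f : RatMap F n m} {g : RatMap F n l} {x : Fin n → C} (hf : x ∈ f.dom C)
    (hg : x ∈ g.dom C) : (f.append g).eval x = Fin.append (f.eval x) (g.eval x) := by
  ext i
  refine Fin.addCases (fun i => ?_) (fun i => ?_) i
  · simp only [eval, append, Fin.append_left, map_mul]
    exact mul_div_mul_right _ _ hg
  · simp only [eval, append, Fin.append_right, map_mul]
    rw [mul_comm (aeval x f.den)]
    exact mul_div_mul_right _ _ hf

end Image

section Conj

variable {K L C : Type*} [Field K] [Field L] [Field C] [Algebra K L] [Algebra L C]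
  {n m l : ℕ} {X : Set (Fin n → C)}

@[simp]
theorem conj_one (f : RatMap L n m) : f.conj (1 : L ≃ₐ[K] L) = f := by
  obtain ⟨num, den⟩ := f
  have h : ∀ p : MvPolynomial (Fin n) L, map ((1 : L ≃ₐ[K] L) : L →+* L) p = p := map_id
  simp [conj, h]

theorem conj_append (f : RatMap L n m) (g : RatMap L n l) (σ : L ≃ₐ[K] L) :
    (f.append g).conj σ = (f.conj σ).append (g.conj σ) := by
  simp only [conj, append, map_mul, RatMap.mk.injEq, and_true]
  ext1 i
  refine Fin.addCases (fun i => ?_) (fun i => ?_) i <;> simp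

/-- If `R = R^σ ∘ f` for a rational map `f : X ⇢ X^σ`, then conjugation by `σ` preserves the
polynomials over `L` vanishing on the image of `R`. -/
theorem map_conj_mem_vanishingIdeal_image {σ : L ≃ₐ[K] L} {f : RatMap L n n} {R : RatMap L n m}
    (hf : f.IsRationalMap X (conjVariety σ X)) (hR : IsComp X R (R.conj σ) f)
    {p : MvPolynomial (Fin m) L} (hp : map (algebraMap L C) p ∈ vanishingIdeal C (R.image X)) :
    map (algebraMap L C) (map (σ : L →+* L) p) ∈ vanishingIdeal C (R.image X) := by
  obtain ⟨q, N, hq⟩ := R.exists_clear_denominators_conj (C := C) (K := K) p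
  have h1 : ∀ r : MvPolynomial (Fin n) L, map ((1 : L ≃ₐ[K] L) : L →+* L) r = r := map_id
  have h1' : ∀ r : MvPolynomial (Fin m) L, map ((1 : L ≃ₐ[K] L) : L →+* L) r = r := map_id
  have hqX : q ∈ vanishingIdeal L X := by
    refine map_mem_vanishingIdeal_iff.1 (mem_vanishingIdeal_of_eventually ?_)
    filter_upwards [hR.eventually, eventually_mem_generic] with x hx hxX
    have hq1 := hq 1 x (by simpa using hx.1)
    rw [conj_one, h1, h1'] at hq1
    have := hp _ ⟨x, ⟨hxX, hx.1⟩, rfl⟩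
    rw [aeval_map_algebraMap] at this ⊢
    rw [hq1, this, mul_zero]
  refine mem_vanishingIdeal_image ?_
  filter_upwards [hR.eventually, eventually_mem_generic] with x hx hxX _
  obtain ⟨-, hxf, hxR, hx⟩ := hx
  have := hf.2 x ⟨hxX, hxf⟩ q hqX
  rw [hq σ _ hxR, ← hx] at this
  rw [aeval_map_algebraMap]
  exact (mul_eq_zero.1 this).resolve_left (den_pow_ne_zero hxR N)

end Conj
end RatMap

open RatMap

section Descent

variable {K L C : Type*} [Field K] [Field L] [Field C] [Algebra K L] [Algebra L C] {n N N' : ℕ}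
  {X : Set (Fin n → C)} {f : (L ≃ₐ[K] L) → RatMap L n n}

theorem IsCompatible.eventually_dom {R : RatMap L n N} (hR : IsCompatible X f R) :
    ∀ᶠ x in generic X, x ∈ R.dom C :=
  (hR 1).eventually.mono fun _ hx => hx.1

theorem IsCompatible.append {R : RatMap L n N} {R' : RatMap L n N'} (hR : IsCompatible X f R)
    (hR' : IsCompatible X f R') : IsCompatible X f (R.append R') := by
  intro σ
  refine isComp_of_eventually ?_
  filter_upwards [(hR σ).eventually, (hR' σ).eventually] with x hx hx'
  rw [conj_append]
  refine ⟨mem_dom_append.2 ⟨hx.1, hx'.1⟩, hx.2.1, mem_dom_append.2 ⟨hx.2.2.1, hx'.2.2.1⟩, ?_⟩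
  rw [eval_append hx.1 hx'.1, eval_append hx.2.2.1 hx'.2.2.1, hx.2.2.2, hx'.2.2.2]

/-- The ideal of the image of a compatible rational map is generated over `K`. -/
theorem vanishingIdeal_image_eq_span [Algebra K C] [IsScalarTower K L C] [FiniteDimensional K L]
    [IsGalois K L] (hX : IsDefinedOver L X) (hf : IsDescentDatum X f)
    {R : RatMap L n N} (hR : IsCompatible X f R) : ∃ S : Set (MvPolynomial (Fin N) K),
      vanishingIdeal C (R.image X) = Ideal.span (map (algebraMap K C) '' S) :=
  eq_span_map_of_stable _
    (fun _ hp φ => map_mapCoeff_mem_vanishingIdeal_image hX (denseIn_of_eventually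
      (eventually_mem_generic.and hR.eventually_dom)) φ hp)
    (fun _ hp σ => map_conj_mem_vanishingIdeal_image (hf.1 σ).1 (hR σ) hp)

end Descent

/-! ### Descending the coefficients of a correspondence -/

section Uniqueness

variable {K F C : Type*} [Field K] [Field F] [Field C] [Algebra K C] [Algebra F C] {n N N' : ℕ}
  {X : Set (Fin n → C)} {Y : Set (Fin N → C)} {Y' : Set (Fin N' → C)}

/-- If an ideal of `C[y]` is stable under coefficientwise functionals `C → K` and contains a
non-zero-divisor modulo the ideal of `Y`, it contains one with coefficients in `K`: otherwise its
polynomials over `K` are zero divisors, hence killed by a single element, which then also kills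
the given non-zero-divisor. -/
theorem exists_nonvanishing_mem (hY : IsDefinedOver K Y) (V : Ideal (MvPolynomial (Fin N) C))
    (hV : ∀ p ∈ V, ∀ φ : C →ₗ[K] K, map (algebraMap K C) (mapCoeff φ p) ∈ V)
    {b₀ : MvPolynomial (Fin N) C} (hb₀ : b₀ ∈ V) (hne : ∀ᶠ y in generic Y, aeval y b₀ ≠ 0) :
    ∃ b : MvPolynomial (Fin N) K, map (algebraMap K C) b ∈ V ∧
      ∀ᶠ y in generic Y, aeval y b ≠ 0 := by
  let I := vanishingIdeal K Y
  let W := (V.comap (map (algebraMap K C))).map (Ideal.Quotient.mk I)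
  have hW : ¬ Disjoint (W : Set (MvPolynomial (Fin N) K ⧸ I))
      (nonZeroDivisors (MvPolynomial (Fin N) K ⧸ I)) := by
    intro h
    obtain ⟨c, hc, hc0⟩ := SetLike.exists_of_lt
      (Ideal.bot_lt_annihilator_of_disjoint_nonZeroDivisors h)
    obtain ⟨c, rfl⟩ := Ideal.Quotient.mk_surjective c
    refine hc0 ?_
    rw [Submodule.mem_annihilator] at hc
    rw [Submodule.mem_bot, Ideal.Quotient.eq_zero_iff_mem, ← map_mem_vanishingIdeal_iff]
    refine mul_mem_vanishingIdeal_cancel hne (mem_of_forall_mapCoeff_mem (F := K) _ _ fun φ => ?_)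
    rw [mapCoeff_mul_map, map_mem_vanishingIdeal_iff]
    have := hc _ (Ideal.mem_map_of_mem (Ideal.Quotient.mk I)
      (Ideal.mem_comap.2 (hV b₀ hb₀ φ)))
    rwa [smul_eq_mul, ← map_mul, Ideal.Quotient.eq_zero_iff_mem, mul_comm] at this
  obtain ⟨b, hbW, hb⟩ := Set.not_disjoint_iff.1 hW
  obtain ⟨b, hbV, rfl⟩ := (Ideal.mem_map_iff_of_surjective _ Ideal.Quotient.mk_surjective).1 hbW
  -- A non-zero-divisor over `K` remains one over `C`, as seen on coefficientwise functionals.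
  refine ⟨b, hbV, eventually_generic.2 ⟨map (algebraMap K C) b, fun p hp => ?_,
    fun y _ hy => by rwa [aeval_map_algebraMap] at hy⟩⟩
  refine mem_of_forall_mapCoeff_mem (F := K) _ _ fun φ => ?_
  have := hY.map_mapCoeff_mem φ hp
  rw [mul_comm, mapCoeff_mul_map, map_mem_vanishingIdeal_iff] at this
  rw [map_mem_vanishingIdeal_iff, ← Ideal.Quotient.eq_zero_iff_mem]
  refine (mem_nonZeroDivisors_iff.1 hb).2 _ ?_
  rw [← map_mul, Ideal.Quotient.eq_zero_iff_mem]
  exact this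

/-- The polynomials `b` such that every coordinate `y'ⱼ` is, on the set `Z` of points `(y, y')`,
of the form `aⱼ(y) / b(y)`. -/
def denominatorIdeal (N N' : ℕ) (Z : Set (Fin (N + N') → C)) : Ideal (MvPolynomial (Fin N) C) where
  carrier := {b | ∀ j, ∃ a, rename (Fin.castAdd N') b * MvPolynomial.X (Fin.natAdd N j) -
    rename (Fin.castAdd N') a ∈ vanishingIdeal C Z}
  zero_mem' _ := ⟨0, by simp⟩
  add_mem' {b c} hb hc j := by
    obtain ⟨a, ha⟩ := hb j
    obtain ⟨a', ha'⟩ := hc j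
    refine ⟨a + a', ?_⟩
    convert Ideal.add_mem _ ha ha' using 1
    simp only [map_add]
    ring
  smul_mem' c b hb j := by
    obtain ⟨a, ha⟩ := hb j
    refine ⟨c * a, ?_⟩
    convert Ideal.mul_mem_left _ (rename (Fin.castAdd N') c) ha using 1
    simp only [map_mul, smul_eq_mul]
    ring

theorem aeval_append_rename {A : Type*} [Field A] [Algebra A C] (u : Fin N → C) (v : Fin N' → C)
    (p : MvPolynomial (Fin N) A) :
    aeval (Fin.append u v) (rename (Fin.castAdd N') p) = aeval u p := by
  rw [aeval_rename]
  congr 2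
  ext i
  simp

theorem aeval_append_eq (u : Fin N → C) (v : Fin N' → C) (a b : MvPolynomial (Fin N) C)
    (j : Fin N') :
    aeval (Fin.append u v) (rename (Fin.castAdd N') b * MvPolynomial.X (Fin.natAdd N j) -
      rename (Fin.castAdd N') a) = aeval u b * v j - aeval u a := by
  rw [map_sub, map_mul, aeval_append_rename, aeval_append_rename, aeval_X, Fin.append_right]

/-- Let `R : X ⇢ Y` be birational with inverse `G`, and `R' : X ⇢ Y'` a rational map. If the graph
of the correspondence `(R, R')` between `Y` and `Y'` has its ideal generated over `K`, then
`R' ∘ R⁻¹` is given by quotients of polynomials over `K`. -/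
theorem exists_ratMap_over (hY : IsDefinedOver K Y) (hY' : zeroLocus C (vanishingIdeal C Y') = Y')
    {R : RatMap F n N} {G : RatMap C N n} {R' : RatMap F n N'}
    (hR : R.IsRationalMap X Y) (hG : G.IsRationalMap Y X)
    (hGR : IsComp X (RatMap.id C n) G R) (hRG : IsComp Y (RatMap.id C N) R G)
    (hR' : R'.IsRationalMap X Y') {S : Set (MvPolynomial (Fin (N + N')) K)}
    (hS : vanishingIdeal C ((R.append R').image X) = Ideal.span (map (algebraMap K C) '' S)) :
    ∃ J : RatMap K N N', J.IsRationalMap Y Y' ∧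
      ∀ᶠ x in generic X, R.eval x ∈ J.dom C ∧ J.eval (R.eval x) = R'.eval x := by
  set Z := (R.append R').image X
  have tR := tendsto_generic hR hG hGR hRG
  have tG := tendsto_generic hG hR hRG hGR
  have hR'd := eventually_dom hR'.1
  obtain ⟨B, M₀, hB, -⟩ := G.exists_clear_denominators (map (algebraMap F C) R'.den)
  choose A M hA _ using fun j => G.exists_clear_denominators (map (algebraMap F C) (R'.num j))
  simp only [aeval_map_algebraMap] at hB hA
  -- `R' ∘ G` has a common denominator `b₀` over `C`, the numerators being obtained from `A`.
  set b₀ := B * G.den ^ (∑ j, M j)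
  have hb₀ : b₀ ∈ denominatorIdeal N N' Z := by
    intro j
    have hM : M j ≤ ∑ j, M j := Finset.single_le_sum (fun _ _ => Nat.zero_le _) (Finset.mem_univ j)
    obtain ⟨k, hk⟩ := Nat.exists_eq_add_of_le hM
    refine ⟨A j * G.den ^ M₀ * G.den ^ k, mem_vanishingIdeal_image ?_⟩
    filter_upwards [hGR.eventually] with x hx hxd
    obtain ⟨-, hxR, hxG, hx⟩ := hx
    rw [eval_id] at hx
    have hxR' := (mem_dom_append.1 hxd).2
    rw [eval_append hxR hxR', aeval_append_eq]
    simp only [b₀, map_mul, map_pow, hB _ hxG, hA j _ hxG, ← hx, num_eq hxR', hk]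
    ring
  have hb₀ne : ∀ᶠ y in generic Y, aeval y b₀ ≠ 0 := by
    filter_upwards [tG.eventually hR'd, eventually_dom hG.1] with y hy hyG
    simp only [b₀, map_mul, map_pow, hB y hyG]
    exact mul_ne_zero (mul_ne_zero (den_pow_ne_zero hyG _) hy) (den_pow_ne_zero hyG _)
  obtain ⟨b, hb, hbne⟩ := exists_nonvanishing_mem hY (denominatorIdeal N N' Z)
    (fun p hp φ j => by
      obtain ⟨a, ha⟩ := hp j
      refine ⟨map (algebraMap K C) (mapCoeff φ a), ?_⟩
      rw [hS] at ha ⊢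
      have := map_mapCoeff_mem_span S φ ha
      rwa [mapCoeff_sub, mapCoeff_mul_X, mapCoeff_rename, mapCoeff_rename, map_sub, map_mul,
        map_X, map_rename, map_rename] at this) hb₀ hb₀ne
  -- A retraction moves the numerators to `K` and fixes the denominator.
  obtain ⟨π, hπ⟩ := exists_retraction K C
  have hnum : ∀ j, ∃ a : MvPolynomial (Fin N) K,
      rename (Fin.castAdd N') (map (algebraMap K C) b) * MvPolynomial.X (Fin.natAdd N j) -
        rename (Fin.castAdd N') (map (algebraMap K C) a) ∈ vanishingIdeal C Z := by
    intro j
    obtain ⟨a, ha⟩ := hb j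
    refine ⟨mapCoeff π a, ?_⟩
    rw [hS] at ha ⊢
    have := map_mapCoeff_mem_span S π ha
    rwa [mapCoeff_sub, mapCoeff_mul_X, mapCoeff_rename, mapCoeff_rename, mapCoeff_map π hπ,
      map_sub, map_mul, map_X, map_rename, map_rename] at this
  choose a ha using hnum
  let J : RatMap K N N' := ⟨a, b⟩
  have hJR : ∀ᶠ x in generic X, R.eval x ∈ J.dom C ∧ J.eval (R.eval x) = R'.eval x := by
    filter_upwards [tR.eventually hbne, eventually_dom hR.1, hR'd, eventually_mem_generic]
      with x hxb hxR hxR' hxX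
    refine ⟨hxb, funext fun j => (div_eq_iff hxb).2 ?_⟩
    have := ha j _ ⟨x, ⟨hxX, mem_dom_append.2 ⟨hxR, hxR'⟩⟩, rfl⟩
    rw [eval_append hxR hxR', aeval_append_eq, aeval_map_algebraMap, aeval_map_algebraMap] at this
    rw [mul_comm]
    exact (sub_eq_zero.1 this).symm
  refine ⟨J, ⟨denseIn_of_eventually (eventually_mem_generic.and hbne), fun y hy => ?_⟩, hJR⟩
  -- `Y'` is closed, so it suffices that generic points `y`, which are `R (G y)`, are sent to `Y'`.
  rw [← hY']
  intro p hp
  refine aeval_eval_eq_zero_of_eventually ?_ hy.1 hy.2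
  filter_upwards [tG.eventually hJR, tG.eventually hR'd, hRG.eventually,
    eventually_mem_generic] with y hyJ hyR' hyR hyY _
  obtain ⟨-, hyG, -, hyR⟩ := hyR
  rw [eval_id] at hyR
  rw [← hyR] at hyJ
  rw [hyJ.2]
  exact hp _ (hR'.2 _ ⟨hG.2 y ⟨hyY, hyG⟩, hyR'⟩)

end Uniqueness

theorem vanishingIdeal_zeroLocus_vanishingIdeal {C : Type*} [Field C] {n : ℕ}
    (Z : Set (Fin n → C)) :
    vanishingIdeal C (zeroLocus C (vanishingIdeal C Z)) = vanishingIdeal C Z :=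
  zeroLocus_vanishingIdeal_galoisConnection.u_l_u_eq_u (Opposite.op Z).unop

/-! ### Linear combinations of rational maps -/

namespace RatMap

section LinComb

variable {F C : Type*} [Field F] [Field C] [Algebra F C] {n m d : ℕ} {ι : Type*} [Fintype ι]

open Classical in
/-- The map to `C^(m * d)` with coordinates `∑ᵢ cᵢₖ gᵢⱼ`, indexed by the pairs `(j, k)`. -/
def linComb (c : ι → Fin d → F) (g : ι → RatMap F n m) : RatMap F n (m * d) where
  num j := ∑ i, MvPolynomial.C (c i (finProdFinEquiv.symm j).2) *
    ((g i).num (finProdFinEquiv.symm j).1 * ∏ k ∈ Finset.univ.erase i, (g k).den)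
  den := ∏ i, (g i).den

theorem mem_dom_linComb {c : ι → Fin d → F} {g : ι → RatMap F n m} {x : Fin n → C} :
    x ∈ (linComb c g).dom C ↔ ∀ i, x ∈ (g i).dom C := by
  simp [dom, linComb, Finset.prod_ne_zero_iff]

theorem eval_linComb {c : ι → Fin d → F} {g : ι → RatMap F n m} {x : Fin n → C}
    (hx : ∀ i, x ∈ (g i).dom C) (j : Fin m) (k : Fin d) :
    (linComb c g).eval x (finProdFinEquiv (j, k)) =
      ∑ i, algebraMap F C (c i k) * (g i).eval x j := by
  classical
  refine (div_eq_iff (mem_dom_linComb.2 hx : x ∈ (linComb c g).dom C)).2 ?_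
  simp only [linComb, map_sum, map_mul, map_prod, Equiv.symm_apply_apply, Finset.sum_mul]
  refine Finset.sum_congr rfl fun i _ => ?_
  rw [← Finset.mul_prod_erase _ _ (Finset.mem_univ i), num_eq (hx i), aeval_C]
  ring

theorem conj_linComb {K : Type*} [Field K] [Algebra K F] (c : ι → Fin d → F)
    (g : ι → RatMap F n m) (τ : F ≃ₐ[K] F) :
    (linComb c g).conj τ = linComb (fun i k => τ (c i k)) (fun i => (g i).conj τ) := by
  simp [conj, linComb, map_sum, map_prod]

end LinComb

end RatMap

open RatMap

/-! ### Polynomial maps and polynomial inverses -/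

section Polynomial

variable {F C : Type*} [Field F] [Field C] [Algebra F C] {n m : ℕ} {X : Set (Fin n → C)}

/-- A rational map with coefficients in `F` which is polynomial over `C` is polynomial over `F`:
apply a retraction `C → F` to the coefficients. -/
theorem RatMap.IsPolynomial.descend (hX : IsDefinedOver F X) {f : RatMap F n m}
    (hf : DenseIn (X ∩ f.dom C) X) (h : f.IsPolynomial C X) : f.IsPolynomial F X := by
  obtain ⟨p, hp⟩ := h
  obtain ⟨π, hπ⟩ := exists_retraction F C
  refine ⟨fun j => mapCoeff π (p j), fun x hx => funext fun j => ?_⟩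
  have hmem : map (algebraMap F C) (f.num j) - p j * map (algebraMap F C) f.den ∈
      vanishingIdeal C X := hf _ fun y hy => by
    rw [map_sub, map_mul, aeval_map_algebraMap, aeval_map_algebraMap, num_eq hy.2, hp y hy]
    ring
  have := hX.map_mapCoeff_mem π hmem x hx.1
  rw [mapCoeff_sub, mapCoeff_map π hπ, mapCoeff_mul_map, aeval_map_algebraMap, map_sub, map_mul]
    at this
  exact (div_eq_iff hx.2).2 (sub_eq_zero.1 this)

/-- A rational map given by polynomials. -/
def RatMap.ofPolynomials (q : Fin m → MvPolynomial (Fin n) F) : RatMap F n m := ⟨q, 1⟩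

theorem mem_dom_ofPolynomials (q : Fin m → MvPolynomial (Fin n) F) (x : Fin n → C) :
    x ∈ (ofPolynomials q).dom C := by
  simp [dom, ofPolynomials]

theorem eval_ofPolynomials (q : Fin m → MvPolynomial (Fin n) F) (x : Fin n → C) :
    (ofPolynomials q).eval x = fun j => aeval x (q j) := by
  ext j; simp [RatMap.eval, ofPolynomials]

/-- A polynomial map `q` with `q ∘ R = id` on the domain of `R` maps the Zariski closure of the
image of `R` into `X`. -/
theorem polynomial_leftInverse_mem (hX : zeroLocus C (vanishingIdeal C X) = X) {R : RatMap F n m}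
    {q : Fin n → MvPolynomial (Fin m) F}
    (hq : ∀ x ∈ X ∩ R.dom C, (fun i => aeval (R.eval x) (q i)) = x) :
    ∀ y ∈ zeroLocus C (vanishingIdeal C (R.image X)), (fun i => aeval y (q i)) ∈ X := by
  intro y hy
  rw [← hX]
  intro p hp
  have hmem : bind₁ (fun i => map (algebraMap F C) (q i)) p ∈ vanishingIdeal C (R.image X) := by
    rintro _ ⟨x, hx, rfl⟩
    rw [aeval_bind₁]
    simp only [aeval_map_algebraMap]
    rw [hq x hx]
    exact hp x hx.1
  have := hy _ hmem
  rw [aeval_bind₁] at this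
  simpa only [aeval_map_algebraMap] using this

/-- A rational map with a polynomial left inverse is birational onto the Zariski closure of its
image. -/
theorem isBirational_image (hX : zeroLocus C (vanishingIdeal C X) = X) {R : RatMap F n m}
    (hR : DenseIn (X ∩ R.dom C) X) {q : Fin n → MvPolynomial (Fin m) F}
    (hq : ∀ x ∈ X ∩ R.dom C, (fun i => aeval (R.eval x) (q i)) = x) :
    R.IsBirational F X (zeroLocus C (vanishingIdeal C (R.image X))) := by
  refine ⟨⟨hR, fun x hx => zeroLocus_vanishingIdeal_le _ ⟨x, hx, rfl⟩⟩, ofPolynomials q,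
    ⟨fun p hp y hy => hp y ⟨hy, mem_dom_ofPolynomials q y⟩, fun y hy => ?_⟩, ?_, ?_⟩
  · rw [eval_ofPolynomials]
    exact polynomial_leftInverse_mem hX hq y hy.1
  · intro p hp
    refine hR p fun x hx => hp x ⟨hx.1, mem_dom_id x, hx.2, mem_dom_ofPolynomials q _, ?_⟩
    rw [eval_id, eval_ofPolynomials, hq x hx]
  · intro p hp y hy
    refine hy p ?_
    rintro _ ⟨x, hx, rfl⟩
    refine hp _ ⟨zeroLocus_vanishingIdeal_le _ ⟨x, hx, rfl⟩, mem_dom_id _,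
      mem_dom_ofPolynomials q _, ?_, ?_⟩
    · rw [eval_ofPolynomials, hq x hx]
      exact hx.2
    · rw [eval_id, eval_ofPolynomials, hq x hx]

/-- A polynomial map with a polynomial left inverse is biregular onto the Zariski closure of its
image: the identities hold on dense subsets, hence everywhere. -/
theorem isBiregular_image (hX : zeroLocus C (vanishingIdeal C X) = X) {R : RatMap F n m}
    (hR : DenseIn (X ∩ R.dom C) X) {q : Fin n → MvPolynomial (Fin m) F}
    (hq : ∀ x ∈ X ∩ R.dom C, (fun i => aeval (R.eval x) (q i)) = x) (hpol : R.IsPolynomial F X) :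
    R.IsBiregular F X (zeroLocus C (vanishingIdeal C (R.image X))) := by
  obtain ⟨p, hp⟩ := hpol
  refine ⟨p, q, hp, fun x hx => ⟨fun r hr => ?_, funext fun i => ?_⟩,
    fun y hy => ⟨polynomial_leftInverse_mem hX hq y hy, funext fun j => ?_⟩⟩
  · have := hR (bind₁ (fun j => map (algebraMap F C) (p j)) r) (fun x hx => ?_) x hx
    · rw [aeval_bind₁] at this
      simpa only [aeval_map_algebraMap] using this
    · rw [aeval_bind₁]
      simp only [aeval_map_algebraMap]
      rw [← hp x hx]
      exact hr _ ⟨x, hx, rfl⟩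
  · have := hR (map (algebraMap F C) (bind₁ p (q i) - MvPolynomial.X i)) (fun x hx => ?_) x hx
    · rw [aeval_map_algebraMap, map_sub, aeval_bind₁, aeval_X] at this
      exact sub_eq_zero.1 this
    · rw [aeval_map_algebraMap, map_sub, aeval_bind₁, aeval_X, ← hp x hx, sub_eq_zero]
      exact congrFun (hq x hx) i
  · have := hy (map (algebraMap F C) (bind₁ q (p j) - MvPolynomial.X j)) ?_
    · rw [aeval_map_algebraMap, map_sub, aeval_bind₁, aeval_X] at this
      exact sub_eq_zero.1 this
    · rintro _ ⟨x, hx, rfl⟩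
      rw [aeval_map_algebraMap, map_sub, aeval_bind₁, aeval_X, hq x hx, hp x hx, sub_self]

end Polynomial

/-! ### The trace map of a descent datum -/

section Existence

variable {K L C : Type*} [Field K] [Field L] [Field C] [Algebra K L] [Algebra L C] {n d : ℕ}
  {X : Set (Fin n → C)} {f : (L ≃ₐ[K] L) → RatMap L n n}

theorem conjVariety_one (hX : IsDefinedOver L X) : conjVariety (1 : L ≃ₐ[K] L) X = X := by
  have h : ∀ p : MvPolynomial (Fin n) L, map ((1 : L ≃ₐ[K] L) : L →+* L) p = p := map_id
  obtain ⟨hX, S, hS⟩ := hX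
  refine Set.Subset.antisymm (fun x hx => ?_) fun x hx P hP => ?_
  · rw [← hX, hS, zeroLocus_span]
    rintro _ ⟨p, hp, rfl⟩
    have hpX : p ∈ vanishingIdeal L X :=
      map_mem_vanishingIdeal_iff.1 (hS ▸ Ideal.subset_span ⟨p, hp, rfl⟩)
    simpa only [h, aeval_map_algebraMap] using hx p hpX
  · rw [h]
    exact hP x hx

/-- In a descent datum `f₁ = id`, since `f₁` is idempotent and invertible. -/
theorem IsDescentDatum.eval_one (hX : IsDefinedOver L X) (hf : IsDescentDatum X f) {x : Fin n → C}
    (hxX : x ∈ X) (hx : x ∈ (f 1).dom C) : (f 1).eval x = x := by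
  obtain ⟨h1, g, hg, hgf, hfg⟩ := hf.1 1
  rw [conjVariety_one hX] at h1 hg hfg
  have t := tendsto_generic h1 hg hgf hfg
  have hidem := (hf.2 1 1).eventually
  have key : ∀ᶠ x in generic X, x ∈ (f 1).dom C ∧ (f 1).eval x = x := by
    filter_upwards [hgf.eventually, t.eventually hgf.eventually, hidem] with x hx hfx hffx
    obtain ⟨-, hxf, -, hx⟩ := hx
    have hfx := hfx.2.2.2
    have hffx := hffx.2.2.2
    rw [eval_id] at hx hfx
    rw [conj_one, mul_one] at hffx
    rw [← hffx] at hfx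
    exact ⟨hxf, hfx.trans hx.symm⟩
  ext i
  have hmem : map (algebraMap L C) ((f 1).num i - MvPolynomial.X i * (f 1).den) ∈
      vanishingIdeal C X := by
    refine mem_vanishingIdeal_of_eventually (key.mono fun y hy => ?_)
    rw [aeval_map_algebraMap, map_sub, map_mul, aeval_X, num_eq hy.1, hy.2]
    ring
  have := hmem x hxX
  rw [aeval_map_algebraMap, map_sub, map_mul, aeval_X] at this
  exact (div_eq_iff hx).2 (sub_eq_zero.1 this)

variable [FiniteDimensional K L]

/-- The map with coordinates the traces `∑_σ σ(aₖ) (f_σ)ᵢ` of the functions `aₖ xᵢ`. -/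
def traceMap (f : (L ≃ₐ[K] L) → RatMap L n n) (a : Fin d → L) : RatMap L n (n * d) :=
  linComb (fun σ k => σ (a k)) f

theorem eventually_dom_descentDatum (hf : IsDescentDatum X f) :
    ∀ᶠ x in generic X, ∀ σ, x ∈ (f σ).dom C :=
  Filter.eventually_all.2 fun σ => eventually_dom (hf.1 σ).1.1

/-- By the cocycle condition, `R^σ ∘ f_σ` permutes the summands of the trace map `R`. -/
theorem isCompatible_traceMap (hf : IsDescentDatum X f) (a : Fin d → L) :
    IsCompatible X f (traceMap f a) := by
  intro σ
  refine isComp_of_eventually ?_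
  filter_upwards [eventually_dom_descentDatum hf,
    Filter.eventually_all.2 fun τ => (hf.2 σ τ).eventually] with x hx hστ
  have hd : ∀ τ, (f σ).eval x ∈ ((f τ).conj σ).dom C := fun τ => (hστ τ).2.2.1
  rw [traceMap, conj_linComb]
  refine ⟨mem_dom_linComb.2 hx, hx σ, mem_dom_linComb.2 hd, ?_⟩
  ext j
  obtain ⟨⟨i, k⟩, rfl⟩ := finProdFinEquiv.surjective j
  rw [eval_linComb hx, eval_linComb hd]
  refine (Fintype.sum_equiv (Equiv.mulLeft σ) _ _ fun τ => ?_).symm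
  rw [← (hστ τ).2.2.2]
  rfl

/-- The inverse of the trace map is linear: `xᵢ = ∑ₖ bₖ ∑_σ σ(aₖ) (f_σ)ᵢ`. -/
theorem traceMap_leftInverse (hX : IsDefinedOver L X) (hf : IsDescentDatum X f) {a b : Fin d → L}
    (h1 : ∑ k, b k * a k = 1) (hne : ∀ σ : L ≃ₐ[K] L, σ ≠ 1 → ∑ k, b k * σ (a k) = 0) :
    ∀ x ∈ X ∩ (traceMap f a).dom C, (fun i => aeval ((traceMap f a).eval x)
      (∑ k, MvPolynomial.C (b k) * MvPolynomial.X (finProdFinEquiv (i, k)))) = x := by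
  rintro x ⟨hxX, hx⟩
  rw [traceMap, mem_dom_linComb] at hx
  ext i
  simp only [map_sum, map_mul, aeval_X, aeval_C, traceMap, eval_linComb hx, Finset.mul_sum,
    ← mul_assoc]
  rw [Finset.sum_comm]
  simp only [← Finset.sum_mul, ← map_mul, ← map_sum]
  rw [Fintype.sum_eq_single 1 fun σ hσ => by rw [hne σ hσ, map_zero, zero_mul]]
  simp only [AlgEquiv.one_apply, h1, map_one, one_mul]
  rw [hf.eval_one hX hxX (hx 1)]

theorem isPolynomial_traceMap {E : Type*} [Field E] [Algebra L E] [Algebra E C]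
    [IsScalarTower L E C] (a : Fin d → L) (h : ∀ σ, (f σ).IsPolynomial E X) :
    (traceMap f a).IsPolynomial E X := by
  choose p hp using h
  refine ⟨fun j => ∑ σ : L ≃ₐ[K] L, MvPolynomial.C (algebraMap L E
    (σ (a (finProdFinEquiv.symm j).2))) * p σ (finProdFinEquiv.symm j).1, ?_⟩
  rintro x ⟨hxX, hx⟩
  rw [traceMap, mem_dom_linComb] at hx
  ext j
  obtain ⟨⟨i, k⟩, rfl⟩ := finProdFinEquiv.surjective j
  simp only [traceMap, eval_linComb hx, map_sum, map_mul, aeval_C, Equiv.symm_apply_apply,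
    ← IsScalarTower.algebraMap_apply]
  exact Finset.sum_congr rfl fun σ _ => by rw [hp σ x ⟨hxX, hx σ⟩]

end Existence

end WeilDescent

end

/-! ### Existence and uniqueness of the descended variety -/

open MvPolynomial WeilDescent WeilDescent.RatMap in
theorem mainTheorem1 {K L C : Type*} [Field K] [PerfectField K] [Field L] [Field C]
    [Algebra K L] [Algebra K C] [Algebra L C] [IsScalarTower K L C]
    [FiniteDimensional K L] [IsGalois K L] [IsAlgClosure K C]
    {n : ℕ} (X : Set (Fin n → C)) (hX : WeilDescent.IsDefinedOver L X)
    (f : (L ≃ₐ[K] L) → WeilDescent.RatMap L n n) (hf : WeilDescent.IsDescentDatum X f) :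
    -- existence
    (∃ (N : ℕ) (Y : Set (Fin N → C)) (R : WeilDescent.RatMap L n N),
      WeilDescent.IsDefinedOver K Y ∧
      ((MvPolynomial.vanishingIdeal C X).IsPrime → (MvPolynomial.vanishingIdeal C Y).IsPrime) ∧
      R.IsBirational L X Y ∧
      WeilDescent.IsCompatible X f R ∧
      ((∀ σ, (f σ).IsPolynomial C X) → R.IsBiregular L X Y)) ∧
    -- uniqueness
    (∀ (N N' : ℕ) (Y : Set (Fin N → C)) (Y' : Set (Fin N' → C))
      (R : WeilDescent.RatMap L n N) (R' : WeilDescent.RatMap L n N'),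
      WeilDescent.IsDefinedOver K Y → R.IsBirational C X Y → WeilDescent.IsCompatible X f R →
      WeilDescent.IsDefinedOver K Y' → R'.IsBirational C X Y' → WeilDescent.IsCompatible X f R' →
      ∃ J : WeilDescent.RatMap K N N',
        J.IsBirational K Y Y' ∧ WeilDescent.RatMap.IsComp X R' J R) := by
  classical
  refine ⟨?_, ?_⟩
  · obtain ⟨d, a, b, hab⟩ := exists_galois_coordinates K L
    have hR := isCompatible_traceMap hf a
    have hdense := denseIn_of_eventually (eventually_mem_generic.and hR.eventually_dom)
    have hinv := traceMap_leftInverse (a := a) (b := b) hX hf (by simpa using hab 1)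
      fun σ hσ => by simpa [hσ] using hab σ
    have hY := vanishingIdeal_zeroLocus_vanishingIdeal ((traceMap f a).image X)
    refine ⟨n * d, _, traceMap f a, ⟨?_, ?_⟩, fun hp => ?_,
      isBirational_image hX.1 hdense hinv, hR, fun hpol => ?_⟩
    · rw [hY]
    · rw [hY]
      exact vanishingIdeal_image_eq_span hX hf hR
    · rw [hY]
      exact isPrime_vanishingIdeal_image hdense hp
    · exact isBiregular_image hX.1 hdense hinv (isPolynomial_traceMap a fun σ =>
        (hpol σ).descend hX (hf.1 σ).1.1)
  · intro N N' Y Y' R R' hY hR hRc hY' hR' hRc'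
    obtain ⟨hR, G, hG, hGR, hRG⟩ := hR
    obtain ⟨hR', G', hG', hGR', hRG'⟩ := hR'
    obtain ⟨S, hS⟩ := vanishingIdeal_image_eq_span hX hf (hRc.append hRc')
    obtain ⟨S', hS'⟩ := vanishingIdeal_image_eq_span hX hf (hRc'.append hRc)
    obtain ⟨J, hJ, hJR⟩ := exists_ratMap_over hY hY'.1 hR hG hGR hRG hR' hS
    obtain ⟨J', hJ', hJR'⟩ := exists_ratMap_over hY' hY.1 hR' hG' hGR' hRG' hR hS'
    refine ⟨J, ⟨hJ, J', hJ', isComp_of_eventually ?_, isComp_of_eventually ?_⟩,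
      isComp_of_eventually ?_⟩
    · have t := tendsto_generic hG hR hRG hGR
      filter_upwards [t.eventually hJR, t.eventually hJR', hRG.eventually] with y h h' hy
      have hy := hy.2.2.2
      rw [eval_id] at hy
      rw [← hy] at h h'
      rw [h.2, h'.2]
      exact ⟨mem_dom_id y, h.1, h'.1, eval_id y⟩
    · have t := tendsto_generic hG' hR' hRG' hGR'
      filter_upwards [t.eventually hJR, t.eventually hJR', hRG'.eventually] with y h h' hy
      have hy := hy.2.2.2
      rw [eval_id] at hy
      rw [← hy] at h h'
      rw [h'.2, h.2]
      exact ⟨mem_dom_id y, h'.1, h.1, eval_id y⟩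
    · filter_upwards [hJR, eventually_dom hR.1, eventually_dom hR'.1] with x h hx hx'
      exact ⟨hx', hx, h.1, h.2.symm⟩
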